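/- Let $n,m\in\mathbb N$, let $\Omega\subseteq\mathbb R^n$ be open, and let $F:\Omega\times\mathbb R^{\{p\in\mathbb N^n:\,|p|\le m\}}\to\mathbb R$ be jointly continuous. For $l\in\mathbb N$ let $C^l_{nd}(\Omega)$ be the set of functions $u$ that are defined and of class $C^l$ on $\Omega\setminus\Gamma$ for some closed nowhere dense $\Gamma\subset\Omega$ (depending on $u$), and let $$T(x,D)u(x)=F\big(x,(D^pu(x))_{|p|\le m}\big),\qquad T(x,D):C^m_{nd}(\Omega)\to C^0_{nd}(\Omega).$$ Order $C^0_{nd}(\Omega)$ by $u\le v$ iff $u(x)\le v(x)$ at every $x\in\Omega$ at which both are continuous, identifying $u$ and $v$ if $u\le v\le u$. Order $C^m_{nd}(\Omega)$ by $u\le_T v$ iff $T(x,D)u\le T(x,D)v$, identifying $u$ and $v$ if $T(x,D)u=T(x,D)v$. For a partially ordered set $X$ let $X^\#\supseteq X$ be its Dedekind order completion, i.e. the set of cuts $(L,R)$ with $L,R\subseteq X$ non-empty, $R$ the set of upper bounds of $L$ and $L$ the set of lower bounds of $R$, ordered by inclusion of the sets $L$. Let $(C^0_{nd}(\Omega))^\#$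 and $(C^m_{nd}(\Omega))^\#_T$ be the completions for the two orders above, and let $T(x,D)^\#:(C^m_{nd}(\Omega))^\#_T\to(C^0_{nd}(\Omega))^\#$ send a cut $(L,R)$ to the supremum of $\{T(x,D)u:u\in L\}$. Let $\mathbf H(\Omega)$ be the set of Hausdorff continuous functions on $\Omega$: functions $h$ on $\Omega$ whose values are closed intervals $[\underline h(x),\overline h(x)]$ with end points in $[-\infty,\infty]$, which are single real numbers for all $x$ in a dense subset of $\Omega$, and such that for every such interval valued function $g=[\underline g,\overline g]$ (with no density requirement) with $g(x)\subseteq h(x)$ for all $x\in\Omega$ one has $\liminf_{y\to x}\underline g(y)=\underline h(x)$ and $\limsup_{y\to x}\overline g(y)=\overline h(x)$ for all $x\in\Omega$ (limits over all $y\in\Omega$, $y=x$ included). Order $\mathbf H(\Omega)$ by $h\le k$ iff $\underline h\le\underline k$ and $\overline h\le\overline k$ pointwise. Then: 1. $T(x,D)^\#$ extends $T(x,D)$, and it is an order embedding: $T(x,D)^\#U\le T(x,D)^\#V$ if and only if $U\le V$. 2. One has $$T(x,D)^\#\,(C^m_{nd}(\Omega))^\#_T=(C^0_{nd}(\Omega))^\#$$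 if and only if, for all $x$ in some dense subset of $\Omega$, the function $\xi\mapsto F(x,\xi)$ takes every real value. In this case $T(x,D)^\#$ is an order isomorphism, and for every $f\in(C^0_{nd}(\Omega))^\#$ there is exactly one $U\in(C^m_{nd}(\Omega))^\#_T$ with $T(x,D)^\#U=f$. 3. $(C^0_{nd}(\Omega))^\#\subseteq\mathbf H(\Omega)$: there is an order embedding $e:(C^0_{nd}(\Omega))^\#\to\mathbf H(\Omega)$ such that for every $u\in C^0_{nd}(\Omega)$ one has $e(u)(x)=\{u(x)\}$ at each point $x\in\Omega$ at which $u$ is continuous. Consequently $J=e\circ T(x,D)^\#$ is an order embedding of $(C^m_{nd}(\Omega))^\#_T$ into $\mathbf H(\Omega)$, by which every solution is identified with a Hausdorff continuous function; for $f$ continuous on $\Omega$, $U$ satisfies $T(x,D)^\#U=f$ if and only if $J(U)(x)=\{f(x)\}$ for all $x\in\Omega$. -/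

import Mathlib

open Set Filter Topology TopologicalSpace

/-! ### Partial derivatives and jets -/

/-- The partial derivative `∂g/∂xᵢ`. -/
noncomputable def partialDeriv {n : ℕ} (i : Fin n) (g : EuclideanSpace ℝ (Fin n) → ℝ) :
    EuclideanSpace ℝ (Fin n) → ℝ :=
  fun x => fderiv ℝ g x (EuclideanSpace.single i 1)

/-- The mixed partial derivative `D^p g = ∂₁^{p₁} ⋯ ∂ₙ^{pₙ} g` for a multi-index `p`. -/
noncomputable def mixedPartial {n : ℕ} (p : Fin n → ℕ) (g : EuclideanSpace ℝ (Fin n) → ℝ) :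
    EuclideanSpace ℝ (Fin n) → ℝ :=
  (List.finRange n).foldr (fun i h => (partialDeriv i)^[p i] h) g

/-- The space of values of all partial derivatives of order at most `m` : one real number for
each multi-index `p` with `|p| ≤ m`. -/
abbrev Jet (n m : ℕ) : Type := {p : Fin n → ℕ // ∑ i, p i ≤ m} → ℝ

/-- The jet `(D^p g (x))_{|p| ≤ m}`. -/
noncomputable def jet {n : ℕ} (m : ℕ) (g : EuclideanSpace ℝ (Fin n) → ℝ)
    (x : EuclideanSpace ℝ (Fin n)) : Jet n m :=
  fun p => mixedPartial p.1 g x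

theorem contDiffOn_partialDeriv {n : ℕ} {G : Set (EuclideanSpace ℝ (Fin n))} (hG : IsOpen G)
    (i : Fin n) {k : ℕ} {g : EuclideanSpace ℝ (Fin n) → ℝ}
    (hg : ContDiffOn ℝ ((k + 1 : ℕ) : WithTop ℕ∞) g G) :
    ContDiffOn ℝ (k : WithTop ℕ∞) (partialDeriv i g) G :=
  (hg.fderiv_of_isOpen hG (by norm_cast)).clm_apply contDiffOn_const

theorem contDiffOn_iterate_partialDeriv {n : ℕ} {G : Set (EuclideanSpace ℝ (Fin n))}
    (hG : IsOpen G) (i : Fin n) (j : ℕ) {k : ℕ} {g : EuclideanSpace ℝ (Fin n) → ℝ}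
    (hg : ContDiffOn ℝ ((k + j : ℕ) : WithTop ℕ∞) g G) :
    ContDiffOn ℝ (k : WithTop ℕ∞) ((partialDeriv i)^[j] g) G := by
  induction j generalizing g with
  | zero => simpa using hg
  | succ j ih =>
    rw [Function.iterate_succ_apply]
    exact ih (contDiffOn_partialDeriv hG i hg)

theorem contDiffOn_foldr_partialDeriv {n : ℕ} {G : Set (EuclideanSpace ℝ (Fin n))}
    (hG : IsOpen G) (p : Fin n → ℕ) (L : List (Fin n)) {k : ℕ}
    {g : EuclideanSpace ℝ (Fin n) → ℝ}
    (hg : ContDiffOn ℝ ((k + (L.map p).sum : ℕ) : WithTop ℕ∞) g G) :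
    ContDiffOn ℝ (k : WithTop ℕ∞) (L.foldr (fun i h => (partialDeriv i)^[p i] h) g) G := by
  induction L generalizing k with
  | nil => simpa using hg
  | cons i L ih =>
    refine contDiffOn_iterate_partialDeriv hG i (p i) (ih ?_)
    simpa [add_assoc] using hg

theorem continuousOn_jet {n m : ℕ} {G : Set (EuclideanSpace ℝ (Fin n))} (hG : IsOpen G)
    {g : EuclideanSpace ℝ (Fin n) → ℝ} (hg : ContDiffOn ℝ (m : WithTop ℕ∞) g G) :
    ContinuousOn (jet m g) G := by
  refine continuousOn_pi.2 fun p => ?_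
  have h : ContDiffOn ℝ ((0 : ℕ) : WithTop ℕ∞) (mixedPartial p.1 g) G := by
    refine contDiffOn_foldr_partialDeriv hG p.1 _ (hg.of_le ?_)
    have hp : ((List.finRange n).map p.1).sum ≤ m := by
      have := p.2
      rwa [← List.ofFn_eq_map, List.sum_ofFn]
    rw [zero_add]
    exact_mod_cast hp
  exact h.continuousOn

/-! ### The spaces `C^l_nd(Ω)` -/

/-- `C^l_nd(Ω)`: functions that are defined and of class `C^l` on `Ω ∖ Γ` for some closed nowhere
dense subset `Γ` of `Ω`. Such a function is represented by a function on the whole space; its values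
off `Ω ∖ Γ` carry no information and do not influence its class for the orders below. -/
structure Cnd {n : ℕ} (l : ℕ) (Ω : Opens (EuclideanSpace ℝ (Fin n))) where
  toFun : EuclideanSpace ℝ (Fin n) → ℝ
  exists_contDiffOn : ∃ Γ : Set Ω, IsClosed Γ ∧ IsNowhereDense Γ ∧
    ContDiffOn ℝ (l : WithTop ℕ∞) toFun (Subtype.val '' Γᶜ)

namespace Cnd

variable {n : ℕ} {Ω : Opens (EuclideanSpace ℝ (Fin n))}

/-- Every element of `C^l_nd(Ω)` is continuous on an open dense part of `Ω`. -/
theorem exists_open_dense {l : ℕ} (u : Cnd l Ω) :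
    ∃ G : Set (EuclideanSpace ℝ (Fin n)), IsOpen G ∧ G ⊆ Ω ∧ (Ω : Set _) ⊆ closure G ∧
      ∀ x ∈ G, ContinuousAt u.toFun x := by
  obtain ⟨Γ, hc, hn, hu⟩ := u.exists_contDiffOn
  have hG : IsOpen (Subtype.val '' Γᶜ : Set (EuclideanSpace ℝ (Fin n))) :=
    Ω.isOpen.isOpenMap_subtype_val _ hc.isOpen_compl
  refine ⟨_, hG, by rintro _ ⟨x, -, rfl⟩; exact x.2, fun x hx => ?_, fun x hx =>
    hu.continuousOn.continuousAt (hG.mem_nhds hx)⟩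
  have hd : Dense Γᶜ := (isClosed_isNowhereDense_iff_compl.1 ⟨hc, hn⟩).2
  have := image_closure_subset_closure_image (f := (Subtype.val : Ω → _)) continuous_subtype_val
    (mem_image_of_mem _ (hd ⟨x, hx⟩))
  exact this

/-- The order on `C^0_nd(Ω)`: pointwise, at the points where both functions are continuous. -/
instance : Preorder (Cnd 0 Ω) where
  le u v := ∀ x ∈ Ω, ContinuousAt u.toFun x → ContinuousAt v.toFun x → u.toFun x ≤ v.toFun x
  le_refl u x _ _ _ := le_rfl
  le_trans u v w huv hvw x hx hu hw := by
    obtain ⟨G, -, hGΩ, hd, hv⟩ := v.exists_open_dense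
    obtain ⟨Gu, hGuo, -, hdu, hcu⟩ := u.exists_open_dense
    obtain ⟨Gw, hGwo, -, hdw, hcw⟩ := w.exists_open_dense
    have hxcl : x ∈ closure (G ∩ Gu ∩ Gw) := by
      refine mem_closure_iff.2 fun V hV hxV => ?_
      obtain ⟨b, ⟨hbV, hbΩ⟩, hbu⟩ :=
        mem_closure_iff.1 (hdu hx) (V ∩ Ω) (hV.inter Ω.isOpen) ⟨hxV, hx⟩
      obtain ⟨c, ⟨⟨hcV, hcΩ⟩, hcu'⟩, hcw'⟩ := mem_closure_iff.1 (hdw hbΩ) (V ∩ Ω ∩ Gu)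
        ((hV.inter Ω.isOpen).inter hGuo) ⟨⟨hbV, hbΩ⟩, hbu⟩
      obtain ⟨d, ⟨⟨hdV, hdu'⟩, hdw'⟩, hdG⟩ := mem_closure_iff.1 (hd hcΩ) (V ∩ Gu ∩ Gw)
        ((hV.inter hGuo).inter hGwo) ⟨⟨hcV, hcu'⟩, hcw'⟩
      exact ⟨d, hdV, ⟨hdG, hdu'⟩, hdw'⟩
    have : (𝓝[G ∩ Gu ∩ Gw] x).NeBot := mem_closure_iff_nhdsWithin_neBot.1 hxcl
    refine le_of_tendsto_of_tendsto (hu.tendsto.mono_left nhdsWithin_le_nhds)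
      (hw.tendsto.mono_left nhdsWithin_le_nhds)
      (eventually_nhdsWithin_of_forall (s := G ∩ Gu ∩ Gw) fun y hy => ?_)
    obtain ⟨⟨hyG, hyu⟩, hyw⟩ := hy
    exact (huv y (hGΩ hyG) (hcu y hyu) (hv y hyG)).trans
      (hvw y (hGΩ hyG) (hv y hyG) (hcw y hyw))

/-- Continuous functions on `Ω` as elements of `C^0_nd(Ω)`. -/
def ofContinuousOn (f : EuclideanSpace ℝ (Fin n) → ℝ) (hf : ContinuousOn f Ω) : Cnd 0 Ω :=
  ⟨f, ∅, isClosed_empty, isNowhereDense_empty, contDiffOn_zero.2 (by simpa using hf)⟩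

end Cnd

/-- `C^0_nd(Ω)` as a partially ordered set: two functions that agree wherever both are continuous
(equivalently, off some closed nowhere dense set) are identified. -/
abbrev CndZero {n : ℕ} (Ω : Opens (EuclideanSpace ℝ (Fin n))) : Type :=
  Antisymmetrization (Cnd 0 Ω) (· ≤ ·)

/-! ### The nonlinear partial differential operator and its order -/

/-- `T(x,D) u = F(x, (D^p u(x))_{|p| ≤ m})` as a map `C^m_nd(Ω) → C^0_nd(Ω)`, for `F` jointly
continuous on `Ω × ℝ^{p : |p| ≤ m}`. -/
noncomputable def pdo {n m : ℕ} (Ω : Opens (EuclideanSpace ℝ (Fin n)))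
    (F : EuclideanSpace ℝ (Fin n) × Jet n m → ℝ)
    (hF : ContinuousOn F ((Ω : Set (EuclideanSpace ℝ (Fin n))) ×ˢ univ))
    (u : Cnd m Ω) : Cnd 0 Ω where
  toFun x := F (x, jet m u.toFun x)
  exists_contDiffOn := by
    obtain ⟨Γ, hc, hn, hu⟩ := u.exists_contDiffOn
    have hG : IsOpen (Subtype.val '' Γᶜ : Set (EuclideanSpace ℝ (Fin n))) :=
      Ω.isOpen.isOpenMap_subtype_val _ hc.isOpen_compl
    refine ⟨Γ, hc, hn, contDiffOn_zero.2 ?_⟩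
    refine hF.comp (continuousOn_id.prodMk (continuousOn_jet hG hu)) ?_
    rintro _ ⟨x, -, rfl⟩
    exact ⟨x.2, mem_univ _⟩

/-- For all `x` in a dense subset of `Ω`, the function `ξ ↦ F(x, ξ)` takes every real value: there
the equation `F(x, ξ) = c` in the free real variables `ξ` is solvable for every right-hand side. -/
def HasDenseFullRange {n m : ℕ} (Ω : Opens (EuclideanSpace ℝ (Fin n)))
    (F : EuclideanSpace ℝ (Fin n) × Jet n m → ℝ) : Prop :=
  (Ω : Set (EuclideanSpace ℝ (Fin n))) ⊆
    closure {x | x ∈ Ω ∧ Function.Surjective fun ξ : Jet n m => F (x, ξ)}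

/-- A copy of `C^m_nd(Ω)` that carries the order determined by the operator `T(x,D)` of `F`. -/
structure CndT {n m : ℕ} (Ω : Opens (EuclideanSpace ℝ (Fin n)))
    (F : EuclideanSpace ℝ (Fin n) × Jet n m → ℝ)
    (hF : ContinuousOn F ((Ω : Set (EuclideanSpace ℝ (Fin n))) ×ˢ univ)) where
  val : Cnd m Ω

/-- `u ≤_T v` if and only if `T(x,D) u ≤ T(x,D) v` in `C^0_nd(Ω)`. -/
noncomputable instance {n m : ℕ} (Ω : Opens (EuclideanSpace ℝ (Fin n)))
    (F : EuclideanSpace ℝ (Fin n) × Jet n m → ℝ)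
    (hF : ContinuousOn F ((Ω : Set (EuclideanSpace ℝ (Fin n))) ×ˢ univ)) :
    Preorder (CndT Ω F hF) :=
  Preorder.lift fun u => pdo Ω F hF u.val

/-- `C^m_nd(Ω)` as a partially ordered set for `≤_T`: functions with `T(x,D) u = T(x,D) v` in
`C^0_nd(Ω)` are identified. -/
abbrev CndM {n m : ℕ} (Ω : Opens (EuclideanSpace ℝ (Fin n)))
    (F : EuclideanSpace ℝ (Fin n) × Jet n m → ℝ)
    (hF : ContinuousOn F ((Ω : Set (EuclideanSpace ℝ (Fin n))) ×ˢ univ)) : Type :=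
  Antisymmetrization (CndT Ω F hF) (· ≤ ·)

/-- The operator `T(x,D)` between the partially ordered sets `C^m_nd(Ω)` (with `≤_T`) and
`C^0_nd(Ω)`. -/
noncomputable def pdoHom {n m : ℕ} (Ω : Opens (EuclideanSpace ℝ (Fin n)))
    (F : EuclideanSpace ℝ (Fin n) × Jet n m → ℝ)
    (hF : ContinuousOn F ((Ω : Set (EuclideanSpace ℝ (Fin n))) ×ˢ univ)) :
    CndM Ω F hF →o CndZero Ω :=
  OrderHom.antisymmetrization ⟨fun u => pdo Ω F hF u.val, fun _ _ h => h⟩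

/-! ### The Dedekind order completion -/

/-- The Dedekind order completion `X^#` of a partially ordered set `X`: the cuts `(L, R)`, that is,
`R` is the set of upper bounds of `L` and `L` the set of lower bounds of `R`, with both `L` and `R`
non-empty (so that the completion of `ℚ` is `ℝ`), ordered by inclusion of the left sets. -/
abbrev DedekindCompletion (X : Type*) [PartialOrder X] : Type _ :=
  {A : DedekindCut X // A.left.Nonempty ∧ A.right.Nonempty}

namespace DedekindCompletion

variable {X Y : Type*} [PartialOrder X] [PartialOrder Y]

/-- The canonical embedding `X → X^#`. -/
def of (x : X) : DedekindCompletion X :=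
  ⟨DedekindCut.principal x, ⟨x, le_rfl⟩, ⟨x, le_rfl⟩⟩

/-- The extension `f^# : X^# → Y^#` of a monotone map `f`: a cut `A` is sent to the cut of `Y`
generated by the image of the left set of `A`, that is, to the supremum of that image in `Y^#`. -/
def map (f : X →o Y) (A : DedekindCompletion X) : DedekindCompletion Y :=
  ⟨Concept.ofObjects (· ≤ ·) (f '' A.1.left),
    (A.2.1.image f).mono (subset_lowerPolar_upperPolar (r := (· ≤ ·)) _),
    (A.2.2.image f).mono (DedekindCut.image_right_subset_upperBounds f.monotone A.1)⟩

end DedekindCompletion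

/-- The completion `(C^0_nd(Ω))^#`. -/
abbrev CndZeroSharp {n : ℕ} (Ω : Opens (EuclideanSpace ℝ (Fin n))) : Type :=
  DedekindCompletion (CndZero Ω)

/-- The completion `(C^m_nd(Ω))^#_T`. -/
abbrev CndMSharp {n m : ℕ} (Ω : Opens (EuclideanSpace ℝ (Fin n)))
    (F : EuclideanSpace ℝ (Fin n) × Jet n m → ℝ)
    (hF : ContinuousOn F ((Ω : Set (EuclideanSpace ℝ (Fin n))) ×ˢ univ)) : Type :=
  DedekindCompletion (CndM Ω F hF)

/-- The extended operator `T(x,D)^#`. -/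
noncomputable def pdoSharp {n m : ℕ} (Ω : Opens (EuclideanSpace ℝ (Fin n)))
    (F : EuclideanSpace ℝ (Fin n) × Jet n m → ℝ)
    (hF : ContinuousOn F ((Ω : Set (EuclideanSpace ℝ (Fin n))) ×ˢ univ)) :
    CndMSharp Ω F hF → CndZeroSharp Ω :=
  DedekindCompletion.map (pdoHom Ω F hF)

/-- The element of `(C^0_nd(Ω))^#` given by `u` in `C^0_nd(Ω)`. -/
def CndZeroSharp.of {n : ℕ} {Ω : Opens (EuclideanSpace ℝ (Fin n))} (u : Cnd 0 Ω) :
    CndZeroSharp Ω :=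
  DedekindCompletion.of (toAntisymmetrization (· ≤ ·) u)

/-- The element of `(C^m_nd(Ω))^#_T` given by `u` in `C^m_nd(Ω)`. -/
noncomputable def CndMSharp.of {n m : ℕ} (Ω : Opens (EuclideanSpace ℝ (Fin n)))
    (F : EuclideanSpace ℝ (Fin n) × Jet n m → ℝ)
    (hF : ContinuousOn F ((Ω : Set (EuclideanSpace ℝ (Fin n))) ×ˢ univ)) (u : Cnd m Ω) :
    CndMSharp Ω F hF :=
  DedekindCompletion.of (toAntisymmetrization (· ≤ ·) ⟨u⟩)

/-! ### Hausdorff continuous functions -/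

/-- Hausdorff continuous functions on `X`: functions `x ↦ [lo x, hi x]` whose values are closed
intervals with possibly infinite end points, such that for every interval valued function `g` with
`g x ⊆ [lo x, hi x]` for all `x`, the completed graph of `g`, given by the lower and upper limits of
`g` at each point, is `[lo, hi]`; the values are real numbers on a dense set. -/
@[ext]
structure HausdorffContinuous (X : Type*) [TopologicalSpace X] where
  lo : X → EReal
  hi : X → EReal
  lo_le_hi : ∀ x, lo x ≤ hi x
  graph_completion : ∀ glo ghi : X → EReal,
    (∀ x, lo x ≤ glo x ∧ glo x ≤ ghi x ∧ ghi x ≤ hi x) →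
      ∀ x, liminf glo (𝓝 x) = lo x ∧ limsup ghi (𝓝 x) = hi x
  dense_real : Dense {x | ∃ r : ℝ, lo x = r ∧ hi x = r}

/-- The pointwise order of interval valued functions: `[a, b] ≤ [c, d]` if `a ≤ c` and `b ≤ d`. -/
noncomputable instance {X : Type*} [TopologicalSpace X] : PartialOrder (HausdorffContinuous X) :=
  PartialOrder.lift (fun f => (f.lo, f.hi)) fun _ _ h =>
    HausdorffContinuous.ext (Prod.ext_iff.1 h).1 (Prod.ext_iff.1 h).2

/-!
The operator `pdoHom` is an order embedding by the very definition of the order on its domain, and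
the extension of an order embedding to Dedekind completions is again one
(`DedekindCompletion.map_le_map_iff`). It is onto as soon as each element of the codomain is both
the supremum and the infimum of values of the map (`DedekindCompletion.map_surjective`).

If `F(x, ·)` is onto `ℝ` at densely many `x`, this order density is obtained by approximation: given
`f` in `C^0_nd(Ω)` and `ε > 0`, at densely many points `x` there is a jet `ξ` with
`F(x, ξ) = f(x) - ε/2`, hence a polynomial with that jet (`exists_contDiff_jet_eq`), which by
continuity satisfies `f - ε ≤ T(x,D)u ≤ f` near `x`. Shrinking these neighbourhoods to disjoint open
sets with dense union (`exists_pairwise_disjoint_isOpen_subset`) glues the local solutions to an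
element of `C^m_nd(Ω)`; no matching is needed across the closed nowhere dense remainder. Conversely,
if `F(x, ·)` fails to be onto for all `x` in an open set, each range is an interval bounded on one
side, and by Baire some bound is uniform on a smaller open set, so that a suitable constant is not
attained (`exists_uniform_bound_of_not_hasDenseFullRange`, `hasDenseFullRange_of_surjective`).

A cut of `C^0_nd(Ω)` is turned into a Hausdorff continuous function by taking the pointwise supremum
`φ` of its left set, and then `[I S φ, S I S φ]` with the lower and upper semicontinuous envelopes
`I` and `S`. Since `I S I S = I S`, each end point is an envelope of the other, which is Hausdorff
continuity; Baire's theorem makes the end points agree on a residual set. Members `l` of the left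
set and `r` of the right set satisfy `l ≤ I S φ` and `S I S φ ≤ r` at their points of continuity, which
recovers the order of the cuts (`CndZeroSharp.toHausdorff_le_iff`).
-/

/-! ### Semicontinuous envelopes and Hausdorff continuous functions -/

section Envelopes

variable {X : Type*} [TopologicalSpace X]

/-- The upper semicontinuous envelope of an extended real function (the upper Baire operator). -/
noncomputable def upperEnvelope (f : X → EReal) (x : X) : EReal := limsup f (𝓝 x)

/-- The lower semicontinuous envelope of an extended real function (the lower Baire operator). -/
noncomputable def lowerEnvelope (f : X → EReal) (x : X) : EReal := liminf f (𝓝 x)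

theorem upperEnvelope_mono {f g : X → EReal} (h : f ≤ g) : upperEnvelope f ≤ upperEnvelope g :=
  fun _ => limsup_le_limsup (Eventually.of_forall h)

theorem lowerEnvelope_mono {f g : X → EReal} (h : f ≤ g) : lowerEnvelope f ≤ lowerEnvelope g :=
  fun _ => liminf_le_liminf (Eventually.of_forall h)

theorem le_upperEnvelope (f : X → EReal) : f ≤ upperEnvelope f := fun _ =>
  le_limsup_of_frequently_le (frequently_iff.2 fun hU => ⟨_, mem_of_mem_nhds hU, le_rfl⟩)

theorem lowerEnvelope_le (f : X → EReal) : lowerEnvelope f ≤ f := fun _ =>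
  liminf_le_of_frequently_le (frequently_iff.2 fun hU => ⟨_, mem_of_mem_nhds hU, le_rfl⟩)

theorem isOpen_upperEnvelope_lt (f : X → EReal) (c : EReal) :
    IsOpen {x | upperEnvelope f x < c} := by
  refine isOpen_iff_mem_nhds.2 fun x hx => ?_
  obtain ⟨d, hxd, hdc⟩ := exists_between (show upperEnvelope f x < c from hx)
  filter_upwards [eventually_eventually_nhds.2 (eventually_lt_of_limsup_lt hxd)] with y hy
  exact (limsup_le_of_le (h := hy.mono fun _ => le_of_lt)).trans_lt hdc

theorem isOpen_lt_lowerEnvelope (f : X → EReal) (c : EReal) :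
    IsOpen {x | c < lowerEnvelope f x} := by
  refine isOpen_iff_mem_nhds.2 fun x hx => ?_
  obtain ⟨d, hcd, hdx⟩ := exists_between (show c < lowerEnvelope f x from hx)
  filter_upwards [eventually_eventually_nhds.2 (eventually_lt_of_lt_liminf hdx)] with y hy
  exact hcd.trans_le (le_liminf_of_le (h := hy.mono fun _ => le_of_lt))

theorem upperEnvelope_upperEnvelope (f : X → EReal) :
    upperEnvelope (upperEnvelope f) = upperEnvelope f := by
  refine le_antisymm (fun x => le_of_forall_gt_imp_ge_of_dense fun c hc => ?_)
    (le_upperEnvelope _)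
  exact limsup_le_of_le
    (h := by
      filter_upwards [(isOpen_upperEnvelope_lt f c).mem_nhds hc] with y hy using le_of_lt hy)

theorem lowerEnvelope_lowerEnvelope (f : X → EReal) :
    lowerEnvelope (lowerEnvelope f) = lowerEnvelope f := by
  refine le_antisymm (lowerEnvelope_le _)
    (fun x => le_of_forall_lt_imp_le_of_dense fun c hc => ?_)
  exact le_liminf_of_le
    (h := by
      filter_upwards [(isOpen_lt_lowerEnvelope f c).mem_nhds hc] with y hy using le_of_lt hy)

/-- The lower end point of the Hausdorff continuous function generated by `f`. -/
noncomputable def normalLower (f : X → EReal) : X → EReal := lowerEnvelope (upperEnvelope f)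

/-- The upper end point of the Hausdorff continuous function generated by `f`. -/
noncomputable def normalUpper (f : X → EReal) : X → EReal := upperEnvelope (normalLower f)

theorem normalLower_le_normalUpper (f : X → EReal) : normalLower f ≤ normalUpper f :=
  le_upperEnvelope _

theorem normalUpper_le_upperEnvelope (f : X → EReal) : normalUpper f ≤ upperEnvelope f :=
  (upperEnvelope_mono (lowerEnvelope_le _)).trans (upperEnvelope_upperEnvelope f).le

theorem normalLower_mono {f g : X → EReal} (h : f ≤ g) : normalLower f ≤ normalLower g :=
  lowerEnvelope_mono (upperEnvelope_mono h)

theorem normalUpper_mono {f g : X → EReal} (h : f ≤ g) : normalUpper f ≤ normalUpper g :=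
  upperEnvelope_mono (normalLower_mono h)

theorem lowerEnvelope_normalLower (f : X → EReal) :
    lowerEnvelope (normalLower f) = normalLower f :=
  lowerEnvelope_lowerEnvelope _

theorem upperEnvelope_normalUpper (f : X → EReal) :
    upperEnvelope (normalUpper f) = normalUpper f :=
  upperEnvelope_upperEnvelope _

/-- Alternating the two envelopes stabilises: each end point of the interval generated by `f` is an
envelope of the other one. -/
theorem lowerEnvelope_normalUpper (f : X → EReal) :
    lowerEnvelope (normalUpper f) = normalLower f :=
  le_antisymm (lowerEnvelope_mono (normalUpper_le_upperEnvelope f))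
    ((lowerEnvelope_normalLower f).ge.trans
      (lowerEnvelope_mono (normalLower_le_normalUpper f)))

/-- In a Baire space the two end points agree on a residual set: `normalLower f ≤ p` and
`q ≤ normalUpper f` with `p < q` cannot hold together on a non-empty open set, because
`normalLower f` is the lower envelope of `normalUpper f`. -/
theorem normalLower_eq_normalUpper_residual (f : X → EReal) :
    ∀ᶠ x in residual X, normalLower f x = normalUpper f x := by
  have key : ∀ p q : ℚ, p < q → ∀ᶠ x in residual X,
      (((p : ℝ) : EReal) < normalLower f x ∨ normalUpper f x < ((q : ℝ) : EReal)) := by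
    intro p q hpq
    refine residual_of_dense_open
      ((isOpen_lt_lowerEnvelope _ _).union (isOpen_upperEnvelope_lt _ _)) ?_
    refine dense_iff_inter_open.2 fun V hV ⟨x, hx⟩ => ?_
    by_contra hne
    have hVx : ∀ y ∈ V, normalLower f y ≤ ((p : ℝ) : EReal) ∧
        ((q : ℝ) : EReal) ≤ normalUpper f y := fun y hy => by
      by_contra hcon
      rw [not_and_or, not_le, not_le] at hcon
      exact hne ⟨y, hy, hcon⟩
    have h1 : ((q : ℝ) : EReal) ≤ lowerEnvelope (normalUpper f) x :=
      le_liminf_of_le (h := mem_of_superset (hV.mem_nhds hx) fun y hy => (hVx y hy).2)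
    rw [lowerEnvelope_normalUpper] at h1
    have h2 := h1.trans (hVx x hx).1
    norm_cast at h2
    exact absurd hpq h2.not_gt
  have key' : ∀ᶠ x in residual X, ∀ p q : ℚ, p < q →
      (((p : ℝ) : EReal) < normalLower f x ∨ normalUpper f x < ((q : ℝ) : EReal)) := by
    simp only [eventually_countable_forall]
    exact key
  filter_upwards [key'] with x hx
  refine (normalLower_le_normalUpper f x).antisymm (not_lt.1 fun hlt => ?_)
  obtain ⟨q, hq, hq'⟩ := EReal.lt_iff_exists_rat_btwn.1 hlt
  obtain ⟨p, hp, hp'⟩ := EReal.lt_iff_exists_rat_btwn.1 hq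
  rcases hx p q (by exact_mod_cast hp') with h | h
  · exact h.not_gt hp
  · exact h.not_gt hq'

/-- The Hausdorff continuous function generated by a function `f` whose end points are finite on a
residual set. -/
noncomputable def HausdorffContinuous.generate [BaireSpace X] (f : X → EReal)
    (hlo : ∀ᶠ x in residual X, normalLower f x ≠ ⊥)
    (hhi : ∀ᶠ x in residual X, normalUpper f x ≠ ⊤) : HausdorffContinuous X where
  lo := normalLower f
  hi := normalUpper f
  lo_le_hi := normalLower_le_normalUpper f
  graph_completion glo ghi hg x := by
    have h1 : normalLower f ≤ lowerEnvelope glo :=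
      (lowerEnvelope_normalLower f).ge.trans (lowerEnvelope_mono fun y => (hg y).1)
    have h2 : lowerEnvelope glo ≤ normalLower f :=
      (lowerEnvelope_mono fun y => (hg y).2.1.trans (hg y).2.2).trans
        (lowerEnvelope_normalUpper f).le
    have h3 : normalUpper f ≤ upperEnvelope ghi :=
      upperEnvelope_mono fun y => (hg y).1.trans (hg y).2.1
    have h4 : upperEnvelope ghi ≤ normalUpper f :=
      (upperEnvelope_mono fun y => (hg y).2.2).trans (upperEnvelope_normalUpper f).le
    exact ⟨(h2 x).antisymm (h1 x), (h4 x).antisymm (h3 x)⟩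
  dense_real := by
    refine dense_of_mem_residual ?_
    filter_upwards [normalLower_eq_normalUpper_residual f, hlo, hhi] with x hx hl hh
    refine ⟨(normalLower f x).toReal, ?_, ?_⟩
    · exact (EReal.coe_toReal (hx ▸ hh) hl).symm
    · rw [← hx]
      exact (EReal.coe_toReal (hx ▸ hh) hl).symm

end Envelopes

/-! ### Order embeddings and completions -/

namespace DedekindCompletion

variable {X Y : Type*} [PartialOrder X] [PartialOrder Y]

theorem map_of (f : X →o Y) (x : X) : map f (of x) = of (f x) := by
  apply Subtype.ext
  refine le_antisymm (Concept.ofObjects_le_iff.2 ?_) ?_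
  · rintro _ ⟨y, hy, rfl⟩
    exact f.monotone hy
  · refine DedekindCut.principal_le_iff.2 ?_
    exact subset_lowerPolar_upperPolar (r := (· ≤ ·)) _ ⟨x, le_rfl, rfl⟩

theorem map_le_map_iff (f : X →o Y) (hf : ∀ a b, f a ≤ f b ↔ a ≤ b)
    (A B : DedekindCompletion X) : map f A ≤ map f B ↔ A ≤ B := by
  constructor
  · intro h
    refine Concept.extent_subset_extent_iff.1 fun a ha => ?_
    have hmem : f a ∈ (map f B).1.extent :=
      Concept.extent_subset_extent_iff.2 h
        (subset_lowerPolar_upperPolar (r := (· ≤ ·)) _ ⟨a, ha, rfl⟩)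
    rw [← B.1.lowerPolar_intent]
    intro r hr
    refine (hf a r).1 (hmem ?_)
    exact DedekindCut.image_right_subset_upperBounds f.monotone B.1 ⟨r, hr, rfl⟩
  · intro h
    refine Concept.ofObjects_le_iff.2 ?_
    exact (image_mono (Concept.extent_subset_extent_iff.2 h)).trans
      (subset_lowerPolar_upperPolar (r := (· ≤ ·)) _)

/-- The extension of an order embedding is onto if every element is the supremum of the values below
it and the infimum of the values above it. The preimage of a cut is generated by the preimage of its
left set. -/
theorem map_surjective (f : X →o Y) (hf : ∀ a b, f a ≤ f b ↔ a ≤ b)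
    (hsup : ∀ y, IsLUB (range f ∩ Iic y) y) (hinf : ∀ y, IsGLB (range f ∩ Ici y) y)
    (hbelow : ∀ y, ∃ x, f x ≤ y) (habove : ∀ y, ∃ x, y ≤ f x) :
    Function.Surjective (map f) := by
  intro A
  have hlow : ∀ {y z}, y ≤ z → z ∈ A.1.left → y ∈ A.1.left := fun hyz hz =>
    Concept.mem_extent_of_rel_extent hyz hz
  have hub : ∀ r ∈ A.1.right, ∀ x, r ≤ f x → x ∈ upperBounds (f ⁻¹' A.1.left) :=
    fun r hr x hx a ha => (hf a x).1 ((Concept.rel_extent_intent ha hr).trans hx)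
  let U : DedekindCompletion X := ⟨Concept.ofObjects (· ≤ ·) (f ⁻¹' A.1.left), by
    obtain ⟨l, hl⟩ := A.2.1
    obtain ⟨x, hx⟩ := hbelow l
    exact ⟨x, subset_lowerPolar_upperPolar (r := (· ≤ ·)) _ (hlow hx hl)⟩, by
    obtain ⟨r, hr⟩ := A.2.2
    obtain ⟨x, hx⟩ := habove r
    exact ⟨x, hub r hr x hx⟩⟩
  refine ⟨U, Subtype.ext (le_antisymm (Concept.ofObjects_le_iff.2 ?_)
    (Concept.extent_subset_extent_iff.1 fun l hl b hb => (hsup l).2 ?_))⟩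
  · rintro _ ⟨a, ha, rfl⟩
    rw [← A.1.lowerPolar_intent]
    refine fun r hr => (hinf r).2 ?_
    rintro _ ⟨⟨x, rfl⟩, hx⟩
    exact f.monotone (ha (hub r hr x hx))
  · rintro _ ⟨⟨x, rfl⟩, hx⟩
    exact hb ⟨x, subset_lowerPolar_upperPolar (r := (· ≤ ·)) _ (hlow hx hl), rfl⟩

end DedekindCompletion

/-! ### The order completion of `C^0_nd(Ω)` inside the Hausdorff continuous functions -/

section Embedding

variable {n : ℕ} {Ω : Opens (EuclideanSpace ℝ (Fin n))}

/-- Any two elements of `C^0_nd(Ω)` are both continuous at points arbitrarily close to a given point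
of `Ω`. -/
theorem Cnd.frequently_continuousAt (u v : Cnd 0 Ω) {x : EuclideanSpace ℝ (Fin n)} (hx : x ∈ Ω) :
    ∃ᶠ y in 𝓝 x, y ∈ Ω ∧ ContinuousAt u.toFun y ∧ ContinuousAt v.toFun y := by
  obtain ⟨G, hGo, hGΩ, hd, hu⟩ := u.exists_open_dense
  obtain ⟨H, -, hHΩ, hd', hv⟩ := v.exists_open_dense
  refine frequently_iff.2 fun {V} hV => ?_
  obtain ⟨W, hWV, hWo, hxW⟩ := mem_nhds_iff.1 hV
  obtain ⟨y, hyW, hyG⟩ := mem_closure_iff.1 (hd hx) W hWo hxW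
  obtain ⟨z, ⟨hzW, hzG⟩, hzH⟩ :=
    mem_closure_iff.1 (hd' (hGΩ hyG)) (W ∩ G) (hWo.inter hGo) ⟨hyW, hyG⟩
  exact ⟨z, hWV hzW, hGΩ hzG, hu z hzG, hv z hzH⟩

theorem frequently_nhds_coe_opens {p : EuclideanSpace ℝ (Fin n) → Prop} {x : Ω} :
    (∃ᶠ y : Ω in 𝓝 x, p y) ↔ ∃ᶠ y in 𝓝 (x : EuclideanSpace ℝ (Fin n)), p y := by
  rw [← Ω.isOpen.isOpenEmbedding_subtypeVal.map_nhds_eq x, frequently_map]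
  rfl

theorem eventually_nhds_coe_opens {p : EuclideanSpace ℝ (Fin n) → Prop} {x : Ω}
    (h : ∀ᶠ y in 𝓝 (x : EuclideanSpace ℝ (Fin n)), p y) : ∀ᶠ y : Ω in 𝓝 x, p y :=
  continuous_subtype_val.continuousAt.eventually h

theorem eventually_residual_continuousAt (u : Cnd 0 Ω) :
    ∀ᶠ x : Ω in residual Ω, ContinuousAt u.toFun x := by
  obtain ⟨G, hGo, hGΩ, hd, hu⟩ := u.exists_open_dense
  refine mem_of_superset (residual_of_dense_open (hGo.preimage continuous_subtype_val) ?_)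
    fun x hx => hu x hx
  refine dense_iff_inter_open.2 fun V hV ⟨x, hx⟩ => ?_
  obtain ⟨y, ⟨z, hzV, rfl⟩, hyG⟩ := mem_closure_iff.1 (hd x.2) _
    (Ω.isOpen.isOpenMap_subtype_val V hV) (mem_image_of_mem _ hx)
  exact ⟨z, hzV, hyG⟩

namespace CndZeroSharp

/-- The pointwise supremum of the left set of a cut: each member contributes only at its points of
continuity, so the arbitrary values of a representative elsewhere do not enter. -/
noncomputable def leftSup (A : CndZeroSharp Ω) (x : Ω) : EReal :=
  ⨆ (u : Cnd 0 Ω) (_ : toAntisymmetrization (· ≤ ·) u ∈ A.1.left)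
    (_ : ContinuousAt u.toFun x), (u.toFun x : EReal)

theorem leftSup_mono {A B : CndZeroSharp Ω} (h : A ≤ B) : leftSup A ≤ leftSup B := fun _ =>
  iSup_mono fun _ => iSup_le fun hu =>
    le_iSup_of_le (Concept.extent_subset_extent_iff.2 h hu) le_rfl

theorem le_normalLower_leftSup {A : CndZeroSharp Ω} {u : Cnd 0 Ω}
    (hu : toAntisymmetrization (· ≤ ·) u ∈ A.1.left) {x : Ω} (hx : ContinuousAt u.toFun x) :
    (u.toFun x : EReal) ≤ normalLower (leftSup A) x := by
  refine le_of_forall_lt_imp_le_of_dense fun c hc => ?_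
  have hev : ∀ᶠ y in 𝓝 (x : EuclideanSpace ℝ (Fin n)), c < (u.toFun y : EReal) :=
    (continuous_coe_real_ereal.continuousAt.comp hx).eventually (lt_mem_nhds hc)
  refine le_liminf_of_le (h := ?_)
  filter_upwards [eventually_nhds_coe_opens (eventually_eventually_nhds.2 hev)] with y hy
  refine le_limsup_of_frequently_le ?_
  refine ((frequently_nhds_coe_opens.2 (Cnd.frequently_continuousAt u u y.2)).and_eventually
    (eventually_nhds_coe_opens hy)).mono fun z hz => hz.2.le.trans ?_
  exact le_iSup_of_le u (le_iSup_of_le hu (le_iSup_of_le hz.1.2.1 le_rfl))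

theorem upperEnvelope_leftSup_le {A : CndZeroSharp Ω} {r : Cnd 0 Ω}
    (hr : toAntisymmetrization (· ≤ ·) r ∈ A.1.right) {x : Ω} (hx : ContinuousAt r.toFun x) :
    upperEnvelope (leftSup A) x ≤ (r.toFun x : EReal) := by
  refine le_of_forall_gt_imp_ge_of_dense fun c hc => ?_
  have hev : ∀ᶠ y in 𝓝 (x : EuclideanSpace ℝ (Fin n)), (r.toFun y : EReal) < c :=
    (continuous_coe_real_ereal.continuousAt.comp hx).eventually (gt_mem_nhds hc)
  refine limsup_le_of_le (h := ?_)
  filter_upwards [eventually_nhds_coe_opens (eventually_eventually_nhds.2 hev)] with y hy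
  refine iSup_le fun u => iSup_le fun hu => iSup_le fun huy => not_lt.1 fun hlt => ?_
  have hle : u ≤ r := toAntisymmetrization_le_toAntisymmetrization_iff.1
    (Concept.rel_extent_intent hu hr)
  -- `r` need not be continuous at `y`, but it is so at nearby points where `u` still exceeds `c`.
  have hev' : ∀ᶠ z in 𝓝 (y : EuclideanSpace ℝ (Fin n)), c < (u.toFun z : EReal) :=
    (continuous_coe_real_ereal.continuousAt.comp huy).eventually (lt_mem_nhds hlt)
  obtain ⟨z, ⟨hzΩ, hzu, hzr⟩, hz1, hz2⟩ :=
    ((Cnd.frequently_continuousAt u r y.2).and_eventually (hy.and hev')).exists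
  exact (hz1.trans hz2).not_ge (EReal.coe_le_coe_iff.2 (hle z hzΩ hzu hzr))

theorem normalUpper_leftSup_le {A : CndZeroSharp Ω} {r : Cnd 0 Ω}
    (hr : toAntisymmetrization (· ≤ ·) r ∈ A.1.right) {x : Ω} (hx : ContinuousAt r.toFun x) :
    normalUpper (leftSup A) x ≤ (r.toFun x : EReal) :=
  (normalUpper_le_upperEnvelope _ x).trans (upperEnvelope_leftSup_le hr hx)

/-- The Hausdorff continuous function of a cut. -/
noncomputable def toHausdorff (A : CndZeroSharp Ω) : HausdorffContinuous Ω :=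
  haveI : BaireSpace Ω := Ω.isOpen.baireSpace
  HausdorffContinuous.generate (leftSup A)
    (by
      obtain ⟨l, hl⟩ := A.2.1
      induction l using Antisymmetrization.ind with | _ l =>
      filter_upwards [eventually_residual_continuousAt l] with x hx
      exact ((EReal.bot_lt_coe _).trans_le (le_normalLower_leftSup hl hx)).ne')
    (by
      obtain ⟨r, hr⟩ := A.2.2
      induction r using Antisymmetrization.ind with | _ r =>
      filter_upwards [eventually_residual_continuousAt r] with x hx
      exact ((normalUpper_leftSup_le hr hx).trans_lt (EReal.coe_lt_top _)).ne)

theorem toHausdorff_le_iff (A B : CndZeroSharp Ω) : toHausdorff A ≤ toHausdorff B ↔ A ≤ B := by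
  constructor
  · intro h
    refine Concept.extent_subset_extent_iff.1 fun l hl => ?_
    rw [← B.1.lowerPolar_intent]
    intro r hr
    induction l using Antisymmetrization.ind with | _ l =>
    induction r using Antisymmetrization.ind with | _ r =>
    refine toAntisymmetrization_le_toAntisymmetrization_iff.2 fun x hx hlx hrx => ?_
    refine EReal.coe_le_coe_iff.1 ?_
    calc (l.toFun x : EReal) ≤ normalLower (leftSup A) ⟨x, hx⟩ := 
          le_normalLower_leftSup (x := ⟨x, hx⟩) hl hlx
      _ ≤ normalUpper (leftSup A) ⟨x, hx⟩ := normalLower_le_normalUpper _ _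
      _ ≤ normalUpper (leftSup B) ⟨x, hx⟩ := h.2 ⟨x, hx⟩
      _ ≤ (r.toFun x : EReal) :=
          normalUpper_leftSup_le (x := ⟨x, hx⟩) hr hrx
  · exact fun h => ⟨normalLower_mono (leftSup_mono h), normalUpper_mono (leftSup_mono h)⟩

/-- The embedding of `(C^0_nd(Ω))^#` into the Hausdorff continuous functions. -/
noncomputable def hausdorffEmbedding : CndZeroSharp Ω ↪o HausdorffContinuous Ω :=
  OrderEmbedding.ofMapLEIff toHausdorff toHausdorff_le_iff

theorem hausdorffEmbedding_of (u : Cnd 0 Ω) (x : Ω) (hx : ContinuousAt u.toFun x) :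
    (hausdorffEmbedding (of u)).lo x = (u.toFun x : EReal) ∧
      (hausdorffEmbedding (of u)).hi x = (u.toFun x : EReal) := by
  have h1 : (u.toFun x : EReal) ≤ normalLower (leftSup (of u)) x :=
    le_normalLower_leftSup (A := of u) (mem_Iic.2 le_rfl) hx
  have h2 : normalUpper (leftSup (of u)) x ≤ (u.toFun x : EReal) :=
    normalUpper_leftSup_le (A := of u) (mem_Ici.2 le_rfl) hx
  have h3 := normalLower_le_normalUpper (leftSup (of u)) x
  exact ⟨(h3.trans h2).antisymm h1, h2.antisymm (h1.trans h3)⟩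

end CndZeroSharp

end Embedding

/-! ### Jets: locality and interpolation by polynomials -/

section Jets

variable {n : ℕ}

theorem Filter.EventuallyEq.partialDeriv {g h : EuclideanSpace ℝ (Fin n) → ℝ}
    {x : EuclideanSpace ℝ (Fin n)} (i : Fin n) (hgh : g =ᶠ[𝓝 x] h) :
    partialDeriv i g =ᶠ[𝓝 x] partialDeriv i h :=
  (hgh.fderiv (𝕜 := ℝ)).mono fun y hy => by simp only [_root_.partialDeriv, hy]

theorem Filter.EventuallyEq.mixedPartial {g h : EuclideanSpace ℝ (Fin n) → ℝ}
    {x : EuclideanSpace ℝ (Fin n)} (p : Fin n → ℕ) (hgh : g =ᶠ[𝓝 x] h) :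
    mixedPartial p g =ᶠ[𝓝 x] mixedPartial p h := by
  have hiter : ∀ (i : Fin n) (k : ℕ) (a b : EuclideanSpace ℝ (Fin n) → ℝ), a =ᶠ[𝓝 x] b →
      (_root_.partialDeriv i)^[k] a =ᶠ[𝓝 x] (_root_.partialDeriv i)^[k] b := by
    intro i k
    induction k with
    | zero => exact fun a b h => h
    | succ k ih => exact fun a b h => ih _ _ (h.partialDeriv i)
  unfold _root_.mixedPartial
  induction List.finRange n with
  | nil => exact hgh
  | cons i L ih => exact hiter i (p i) _ _ ih

theorem jet_congr {m : ℕ} {g h : EuclideanSpace ℝ (Fin n) → ℝ}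
    {x : EuclideanSpace ℝ (Fin n)} (hgh : g =ᶠ[𝓝 x] h) : jet m g x = jet m h x :=
  funext fun p => (hgh.mixedPartial p.1).eq_of_nhds

/-- The polynomial function `x ↦ P (x - a)`. -/
noncomputable def centeredEval (a : EuclideanSpace ℝ (Fin n)) (P : MvPolynomial (Fin n) ℝ) :
    EuclideanSpace ℝ (Fin n) → ℝ :=
  fun x => MvPolynomial.eval (fun i => x i - a i) P

theorem contDiff_centeredEval (a : EuclideanSpace ℝ (Fin n)) (P : MvPolynomial (Fin n) ℝ)
    (k : WithTop ℕ∞) : ContDiff ℝ k (centeredEval a P) := by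
  unfold centeredEval
  simp only [MvPolynomial.eval_eq']
  fun_prop

theorem partialDeriv_centeredEval (a : EuclideanSpace ℝ (Fin n)) (P : MvPolynomial (Fin n) ℝ)
    (i : Fin n) : partialDeriv i (centeredEval a P) =
      centeredEval a (MvPolynomial.pderiv i P) := by
  have hd : ∀ Q x, DifferentiableAt ℝ (centeredEval a Q) x := fun Q x =>
    (contDiff_centeredEval a Q 1).differentiable (by norm_num) x
  funext x
  induction P using MvPolynomial.induction_on with
  | C c =>
    have : centeredEval a (MvPolynomial.C c) = fun _ => c := by
      funext y; simp [centeredEval]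
    rw [partialDeriv, this]
    simp [centeredEval]
  | add P Q hP hQ =>
    have : centeredEval a (P + Q) = centeredEval a P + centeredEval a Q := by
      funext y; simp [centeredEval]
    rw [map_add, partialDeriv, this, fderiv_add (hd P x) (hd Q x)]
    simp only [partialDeriv] at hP hQ
    simp [hP, hQ, centeredEval]
  | mul_X P j hP =>
    have : centeredEval a (P * MvPolynomial.X j) =
        centeredEval a P * fun y => y j - a j := by
      funext y; simp [centeredEval]
    have hj : HasFDerivAt (fun y : EuclideanSpace ℝ (Fin n) => y j - a j)
        (EuclideanSpace.proj j : EuclideanSpace ℝ (Fin n) →L[ℝ] ℝ) x :=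
      (EuclideanSpace.proj j : EuclideanSpace ℝ (Fin n) →L[ℝ] ℝ).hasFDerivAt.sub_const _
    simp only [partialDeriv] at hP
    rw [partialDeriv, this, ((hd P x).hasFDerivAt.mul hj).fderiv]
    by_cases h : j = i
    · subst h
      simp [hP, centeredEval]
    · simp [hP, centeredEval, MvPolynomial.pderiv_X_of_ne h, h, mul_comm]

theorem mixedPartial_centeredEval (a : EuclideanSpace ℝ (Fin n)) (p : Fin n → ℕ)
    (P : MvPolynomial (Fin n) ℝ) : mixedPartial p (centeredEval a P) =
      centeredEval a
        ((List.finRange n).foldr (fun i Q => (MvPolynomial.pderiv i)^[p i] Q) P) := by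
  unfold mixedPartial
  induction List.finRange n with
  | nil => rfl
  | cons i L ih =>
    rw [List.foldr_cons, List.foldr_cons, ih]
    exact (Function.Semiconj.iterate_right (f := centeredEval a)
      (fun Q => (partialDeriv_centeredEval a Q i).symm) (p i) _).symm

/-- Iterated formal derivatives shift coefficients, up to a non-zero factor that does not depend on
the polynomial. -/
theorem exists_coeff_iterate_pderiv (i : Fin n) (k : ℕ) (d : Fin n →₀ ℕ) :
    ∃ c : ℝ, c ≠ 0 ∧ ∀ P : MvPolynomial (Fin n) ℝ,
      ((MvPolynomial.pderiv i)^[k] P).coeff d = P.coeff (d + Finsupp.single i k) * c := by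
  induction k with
  | zero => exact ⟨1, one_ne_zero, by simp⟩
  | succ k ih =>
    obtain ⟨c, hc, h⟩ := ih
    refine ⟨((d + Finsupp.single i k) i + 1) * c, mul_ne_zero (by positivity) hc, fun P => ?_⟩
    rw [Function.iterate_succ_apply, h, MvPolynomial.coeff_pderiv, add_assoc,
      ← Finsupp.single_add, mul_assoc]

theorem exists_coeff_foldr_pderiv (p : Fin n → ℕ) (L : List (Fin n)) (d : Fin n →₀ ℕ) :
    ∃ c : ℝ, c ≠ 0 ∧ ∀ P : MvPolynomial (Fin n) ℝ,
      (L.foldr (fun i Q => (MvPolynomial.pderiv i)^[p i] Q) P).coeff d =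
        P.coeff (d + (L.map fun i => Finsupp.single i (p i)).sum) * c := by
  induction L generalizing d with
  | nil => exact ⟨1, one_ne_zero, by simp⟩
  | cons i L ih =>
    obtain ⟨c, hc, h⟩ := exists_coeff_iterate_pderiv i (p i) d
    obtain ⟨c', hc', h'⟩ := ih (d + Finsupp.single i (p i))
    refine ⟨c' * c, mul_ne_zero hc' hc, fun P => ?_⟩
    rw [List.foldr_cons, h, h', List.map_cons, List.sum_cons, add_assoc, mul_assoc]

theorem exists_mixedPartial_centeredEval (p : Fin n → ℕ) :
    ∃ c : ℝ, c ≠ 0 ∧ ∀ (a : EuclideanSpace ℝ (Fin n)) (P : MvPolynomial (Fin n) ℝ),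
      mixedPartial p (centeredEval a P) a = P.coeff (Finsupp.equivFunOnFinite.symm p) * c := by
  obtain ⟨c, hc, h⟩ := exists_coeff_foldr_pderiv p (List.finRange n) 0
  refine ⟨c, hc, fun a P => ?_⟩
  have hp : (0 + ((List.finRange n).map fun i => Finsupp.single i (p i)).sum : Fin n →₀ ℕ) =
      Finsupp.equivFunOnFinite.symm p := by
    rw [zero_add, ← List.ofFn_eq_map, List.sum_ofFn]
    ext i
    simp [Finsupp.finsetSum_apply, Finsupp.single_apply]
  rw [mixedPartial_centeredEval, ← hp, ← h]
  have h0 : (fun i => a i - a i) = (0 : Fin n → ℝ) := by funext i; simp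
  rw [centeredEval, h0, MvPolynomial.eval_zero, MvPolynomial.constantCoeff_eq]

theorem finite_multiIndex (n m : ℕ) : Finite {p : Fin n → ℕ // ∑ i, p i ≤ m} := by
  refine Finite.of_injective (β := Fin n → Fin (m + 1)) (fun p i => ⟨p.1 i, Nat.lt_succ_of_le
    ((Finset.single_le_sum (fun j _ => Nat.zero_le (p.1 j)) (Finset.mem_univ i)).trans p.2)⟩) ?_
  intro p q h
  exact Subtype.ext (funext fun i => congrArg Fin.val (congrFun h i))

/-- Every jet at a point is the jet of a polynomial. -/
theorem exists_contDiff_jet_eq {m : ℕ} (a : EuclideanSpace ℝ (Fin n)) (ξ : Jet n m) :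
    ∃ g : EuclideanSpace ℝ (Fin n) → ℝ, ContDiff ℝ (m : WithTop ℕ∞) g ∧ jet m g a = ξ := by
  classical
  have := finite_multiIndex n m
  have := Fintype.ofFinite {p : Fin n → ℕ // ∑ i, p i ≤ m}
  choose c hc h using fun p : Fin n → ℕ => exists_mixedPartial_centeredEval p
  let P : MvPolynomial (Fin n) ℝ := ∑ q : {p : Fin n → ℕ // ∑ i, p i ≤ m},
    MvPolynomial.monomial (Finsupp.equivFunOnFinite.symm q.1) (ξ q / c q.1)
  refine ⟨centeredEval a P, contDiff_centeredEval a P m, funext fun p => ?_⟩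
  have hP : P.coeff (Finsupp.equivFunOnFinite.symm p.1) = ξ p / c p.1 := by
    simp [P, MvPolynomial.coeff_sum, MvPolynomial.coeff_monomial, Subtype.val_inj]
  rw [jet, h p.1, hP, div_mul_cancel₀ _ (hc p.1)]

end Jets

/-! ### Gluing local solutions -/

section Gluing

/-- A family of open sets can be shrunk to a disjoint family of open sets without losing density:
remove from each member the closure of the union of its predecessors in a well-order. -/
theorem exists_pairwise_disjoint_isOpen_subset {X ι : Type*} [TopologicalSpace X] (V : ι → Set X)
    (hV : ∀ i, IsOpen (V i)) :
    ∃ W : ι → Set X, (∀ i, IsOpen (W i)) ∧ (∀ i, W i ⊆ V i) ∧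
      Pairwise (fun i j => Disjoint (W i) (W j)) ∧
      ⋃ i, V i ⊆ closure (⋃ i, W i) := by
  let r : ι → ι → Prop := WellOrderingRel
  have hr : ∀ {i j}, r i j → ∀ x, x ∈ V i → x ∉ V j \ closure (⋃ k ∈ {k | r k j}, V k) :=
    fun {i j} hij x hx hx' => hx'.2 (subset_closure (mem_biUnion (by exact hij) hx))
  refine ⟨fun j => V j \ closure (⋃ k ∈ {k | r k j}, V k),
    fun j => (hV j).sdiff isClosed_closure, fun j => sdiff_subset, ?_, ?_⟩
  · intro i j hij
    refine disjoint_left.2 fun x hxi hxj => ?_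
    rcases trichotomous_of r i j with h | h | h
    · exact hr h x hxi.1 hxj
    · exact hij h
    · exact hr h x hxj.1 hxi
  · refine iUnion_subset fun i x hx => mem_closure_iff.2 fun U hU hxU => ?_
    -- the first member of the family that meets `U` keeps all of its points in `U`
    obtain ⟨j, ⟨y, hyV, hyU⟩, hmin⟩ := (IsWellFounded.wf (r := r)).has_min
      {j | (V j ∩ U).Nonempty} ⟨i, x, hx, hxU⟩
    refine ⟨y, hyU, mem_iUnion.2 ⟨j, hyV, fun hcl => ?_⟩⟩
    obtain ⟨z, hzU, hz⟩ := mem_closure_iff.1 hcl U hU hyU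
    obtain ⟨k, hk, hzk⟩ := mem_iUnion₂.1 hz
    exact hmin k ⟨z, hzk, hzU⟩ hk

variable {n m : ℕ} {Ω : Opens (EuclideanSpace ℝ (Fin n))}

/-- A pointwise condition on jets that has local `C^m` solutions near a dense set of points has a
solution in `C^m_nd(Ω)`: glue local solutions over disjoint open sets with dense union. -/
theorem exists_cnd_of_locally {p : EuclideanSpace ℝ (Fin n) → Jet n m → Prop}
    {D : Set (EuclideanSpace ℝ (Fin n))} (hD : (Ω : Set (EuclideanSpace ℝ (Fin n))) ⊆ closure D)
    (h : ∀ x ∈ D, ∃ g : EuclideanSpace ℝ (Fin n) → ℝ, ContDiff ℝ (m : WithTop ℕ∞) g ∧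
      ∀ᶠ y in 𝓝 x, y ∈ Ω ∧ p y (jet m g y)) :
    ∃ (u : Cnd m Ω) (G : Set (EuclideanSpace ℝ (Fin n))), IsOpen G ∧ G ⊆ Ω ∧
      (Ω : Set (EuclideanSpace ℝ (Fin n))) ⊆ closure G ∧ ∀ y ∈ G, p y (jet m u.toFun y) := by
  classical
  have h' : ∀ x : D, ∃ (g : EuclideanSpace ℝ (Fin n) → ℝ) (V : Set (EuclideanSpace ℝ (Fin n))),
      ContDiff ℝ (m : WithTop ℕ∞) g ∧ IsOpen V ∧ x.1 ∈ V ∧ ∀ y ∈ V, y ∈ Ω ∧ p y (jet m g y) := by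
    rintro ⟨x, hx⟩
    obtain ⟨g, hg, hev⟩ := h x hx
    obtain ⟨V, hV, hVo, hxV⟩ := eventually_nhds_iff.1 hev
    exact ⟨g, V, hg, hVo, hxV, hV⟩
  choose g V hg hVo hxV hV using h'
  obtain ⟨W, hWo, hWV, hdisj, hcl⟩ := exists_pairwise_disjoint_isOpen_subset V hVo
  let f : EuclideanSpace ℝ (Fin n) → ℝ := fun y =>
    if hy : ∃ i, y ∈ W i then g hy.choose y else 0
  have hf : ∀ i, ∀ y ∈ W i, f =ᶠ[𝓝 y] g i := by
    intro i y hy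
    filter_upwards [(hWo i).mem_nhds hy] with z hz
    have hex : ∃ i, z ∈ W i := ⟨i, hz⟩
    have : hex.choose = i := by
      by_contra hne
      exact disjoint_left.1 (hdisj hne) hex.choose_spec hz
    simp only [f, dif_pos hex, this]
  have hGo : IsOpen (⋃ i, W i) := isOpen_iUnion hWo
  have hGΩ : ⋃ i, W i ⊆ (Ω : Set (EuclideanSpace ℝ (Fin n))) :=
    iUnion_subset fun i y hy => (hV i y (hWV i hy)).1
  have hGd : (Ω : Set (EuclideanSpace ℝ (Fin n))) ⊆ closure (⋃ i, W i) :=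
    hD.trans (closure_minimal
      (fun x hx => hcl (mem_iUnion.2 ⟨⟨x, hx⟩, hxV ⟨x, hx⟩⟩)) isClosed_closure)
  have hGo' : IsOpen (Subtype.val ⁻¹' (⋃ i, W i) : Set Ω) :=
    hGo.preimage continuous_subtype_val
  have hGd' : Dense (Subtype.val ⁻¹' (⋃ i, W i) : Set Ω) := by
    refine dense_iff_inter_open.2 fun U hU ⟨x, hx⟩ => ?_
    obtain ⟨y, ⟨z, hzU, rfl⟩, hy⟩ := mem_closure_iff.1 (hGd x.2) _
      (Ω.isOpen.isOpenMap_subtype_val U hU) (mem_image_of_mem _ hx)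
    exact ⟨z, hzU, hy⟩
  have hΓ := isClosed_isNowhereDense_iff_compl.2
    (⟨by rwa [compl_compl], by rwa [compl_compl]⟩ :
      IsOpen (Subtype.val ⁻¹' (⋃ i, W i) : Set Ω)ᶜᶜ ∧
        Dense (Subtype.val ⁻¹' (⋃ i, W i) : Set Ω)ᶜᶜ)
  refine ⟨⟨f, _, hΓ.1, hΓ.2, ?_⟩, ⋃ i, W i, hGo, hGΩ, hGd, ?_⟩
  · rintro _ ⟨y, hy, rfl⟩
    rw [compl_compl] at hy
    obtain ⟨i, hi⟩ := mem_iUnion.1 hy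
    exact ((hg i).contDiffAt.congr_of_eventuallyEq (hf i _ hi)).contDiffWithinAt
  · intro y hy
    obtain ⟨i, hi⟩ := mem_iUnion.1 hy
    rw [jet_congr (hf i y hi)]
    exact (hV i y (hWV i hi)).2

end Gluing

/-! ### Approximate solutions and solvability -/

section Approximation

variable {n m : ℕ} {Ω : Opens (EuclideanSpace ℝ (Fin n))}

namespace Cnd

theorem le_of_dense {u v : Cnd 0 Ω} {D : Set (EuclideanSpace ℝ (Fin n))}
    (hD : (Ω : Set (EuclideanSpace ℝ (Fin n))) ⊆ closure D)
    (h : ∀ x ∈ D, u.toFun x ≤ v.toFun x) : u ≤ v := fun x hx hu hv => by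
  have : (𝓝[D] x).NeBot := mem_closure_iff_nhdsWithin_neBot.1 (hD hx)
  exact le_of_tendsto_of_tendsto (hu.tendsto.mono_left nhdsWithin_le_nhds)
    (hv.tendsto.mono_left nhdsWithin_le_nhds) (eventually_nhdsWithin_of_forall h)

/-- The function `u + c`. -/
def addConst (u : Cnd 0 Ω) (c : ℝ) : Cnd 0 Ω :=
  ⟨fun x => u.toFun x + c, by
    obtain ⟨Γ, hc, hn, hu⟩ := u.exists_contDiffOn
    exact ⟨Γ, hc, hn, hu.add contDiffOn_const⟩⟩

theorem le_of_forall_addConst_le {u v : Cnd 0 Ω} (h : ∀ ε > 0, u.addConst (-ε) ≤ v) : u ≤ v :=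
  fun x hx hu hv => le_of_forall_pos_le_add fun ε hε => by
    have : u.toFun x + -ε ≤ v.toFun x := h ε hε x hx (hu.add continuousAt_const) hv
    linarith

theorem le_of_forall_le_addConst {u v : Cnd 0 Ω} (h : ∀ ε > 0, u ≤ v.addConst ε) : u ≤ v :=
  fun x hx hu hv => le_of_forall_pos_le_add fun ε hε =>
    h ε hε x hx hu (hv.add continuousAt_const)

end Cnd

variable {F : EuclideanSpace ℝ (Fin n) × Jet n m → ℝ}
  {hF : ContinuousOn F ((Ω : Set (EuclideanSpace ℝ (Fin n))) ×ˢ univ)}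

/-- If the equation `F(x, ξ) = c` is solvable for all `c` at densely many points `x`, every `f` in
`C^0_nd(Ω)` is approximated uniformly from below by values of the operator. -/
theorem HasDenseFullRange.exists_pdo_between (hFR : HasDenseFullRange Ω F) (f : Cnd 0 Ω) {ε : ℝ}
    (hε : 0 < ε) : ∃ u : Cnd m Ω, f.addConst (-ε) ≤ pdo Ω F hF u ∧ pdo Ω F hF u ≤ f := by
  obtain ⟨G, hGo, hGΩ, hGd, hfc⟩ := f.exists_open_dense
  have hD : (Ω : Set (EuclideanSpace ℝ (Fin n))) ⊆
      closure (G ∩ {x | x ∈ Ω ∧ Function.Surjective fun ξ : Jet n m => F (x, ξ)}) :=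
    hGd.trans (closure_minimal (fun x hx => hGo.inter_closure ⟨hx, hFR (hGΩ hx)⟩)
      isClosed_closure)
  obtain ⟨u, H, -, -, hHd, hu⟩ := exists_cnd_of_locally
    (p := fun y η => f.toFun y - ε ≤ F (y, η) ∧ F (y, η) ≤ f.toFun y) hD (by
    rintro x ⟨hxG, hxΩ, hsurj⟩
    -- solve the equation at `x` for a value strictly inside the target interval
    obtain ⟨ξ, hξ⟩ := hsurj (f.toFun x - ε / 2)
    obtain ⟨g, hg, hgx⟩ := exists_contDiff_jet_eq x ξ
    have hjet : ContinuousAt (jet m g) x :=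
      (continuousOn_jet isOpen_univ hg.contDiffOn).continuousAt univ_mem
    have hFx : ContinuousAt F (x, jet m g x) :=
      hF.continuousAt ((Ω.isOpen.prod isOpen_univ).mem_nhds ⟨hxΩ, mem_univ _⟩)
    have hcomp : ContinuousAt (fun y => F (y, jet m g y) - f.toFun y) x :=
      (ContinuousAt.comp (f := fun y => (y, jet m g y)) hFx
        (continuousAt_id.prodMk hjet)).sub (hfc x hxG)
    have hval : F (x, jet m g x) - f.toFun x = -(ε / 2) := by
      rw [hgx]
      simp only at hξ
      rw [hξ]
      ring
    refine ⟨g, hg, ?_⟩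
    filter_upwards [Ω.isOpen.mem_nhds hxΩ,
      hcomp.eventually (lt_mem_nhds
        (show -ε < F (x, jet m g x) - f.toFun x by rw [hval]; linarith)),
      hcomp.eventually (gt_mem_nhds
        (show F (x, jet m g x) - f.toFun x < (0 : ℝ) by rw [hval]; linarith))] with y h1 h2 h3
    exact ⟨h1, by linarith, by linarith⟩)
  exact ⟨u, Cnd.le_of_dense hHd fun y hy => (sub_eq_add_neg _ ε).ge.trans (hu y hy).1,
    Cnd.le_of_dense hHd fun y hy => (hu y hy).2⟩

variable (hF) in
theorem pdoHom_le_iff (a b : CndM Ω F hF) : pdoHom Ω F hF a ≤ pdoHom Ω F hF b ↔ a ≤ b := by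
  induction a using Antisymmetrization.ind with | _ a =>
  induction b using Antisymmetrization.ind with | _ b =>
  exact Iff.rfl

theorem HasDenseFullRange.surjective_pdoSharp (hFR : HasDenseFullRange Ω F) :
    Function.Surjective (pdoSharp Ω F hF) := by
  have hbelow : ∀ y, ∃ x, pdoHom Ω F hF x ≤ y := fun y => by
    induction y using Antisymmetrization.ind with | _ y =>
    obtain ⟨u, -, hu⟩ := hFR.exists_pdo_between (hF := hF) y one_pos
    exact ⟨toAntisymmetrization _ ⟨u⟩, hu⟩
  have happrox : ∀ (y : Cnd 0 Ω) (ε : ℝ), 0 < ε → ∃ u : Cnd m Ω,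
      y ≤ pdo Ω F hF u ∧ pdo Ω F hF u ≤ y.addConst ε := fun y ε hε => by
    obtain ⟨u, hu1, hu2⟩ := hFR.exists_pdo_between (hF := hF) (y.addConst ε) hε
    refine ⟨u, le_trans (Cnd.le_of_dense (D := Ω) subset_closure fun x _ => ?_) hu1, hu2⟩
    simp [Cnd.addConst]
  refine DedekindCompletion.map_surjective _ (pdoHom_le_iff hF) (fun y => ?_) (fun y => ?_)
    hbelow (fun y => ?_)
  · refine ⟨fun z hz => hz.2, fun w hw => ?_⟩
    induction y using Antisymmetrization.ind with | _ y =>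
    induction w using Antisymmetrization.ind with | _ w =>
    refine toAntisymmetrization_le_toAntisymmetrization_iff.2
      (Cnd.le_of_forall_addConst_le fun ε hε => ?_)
    obtain ⟨u, hu1, hu2⟩ := hFR.exists_pdo_between (hF := hF) y hε
    exact hu1.trans (hw ⟨⟨toAntisymmetrization _ ⟨u⟩, rfl⟩, hu2⟩)
  · refine ⟨fun z hz => hz.2, fun w hw => ?_⟩
    induction y using Antisymmetrization.ind with | _ y =>
    induction w using Antisymmetrization.ind with | _ w =>
    refine toAntisymmetrization_le_toAntisymmetrization_iff.2
      (Cnd.le_of_forall_le_addConst fun ε hε => ?_)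
    obtain ⟨u, hu1, hu2⟩ := happrox y ε hε
    exact le_trans (hw ⟨⟨toAntisymmetrization _ ⟨u⟩, rfl⟩, hu1⟩) hu2
  · induction y using Antisymmetrization.ind with | _ y =>
    obtain ⟨u, hu, -⟩ := happrox y 1 one_pos
    exact ⟨toAntisymmetrization _ ⟨u⟩, hu⟩

/-- If some non-empty open subset of `Ω` contains no `x` at which `F(x, ·)` is onto `ℝ`, then
by the Baire category theorem all `F(x, ·)` with `x` in a suitable non-empty open set have a common
upper or a common lower bound. -/
theorem exists_uniform_bound_of_not_hasDenseFullRange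
    (hF : ContinuousOn F ((Ω : Set (EuclideanSpace ℝ (Fin n))) ×ˢ univ))
    (hFR : ¬ HasDenseFullRange Ω F) :
    ∃ (x : EuclideanSpace ℝ (Fin n)) (k : ℝ), x ∈ Ω ∧
      ((∀ᶠ y in 𝓝 x, ∀ ξ, F (y, ξ) ≤ k) ∨ ∀ᶠ y in 𝓝 x, ∀ ξ, k ≤ F (y, ξ)) := by
  obtain ⟨x₀, hx₀, hx₀'⟩ := not_subset.1 hFR
  set W : Set (EuclideanSpace ℝ (Fin n)) :=
    Ω ∩ (closure {x | x ∈ Ω ∧ Function.Surjective fun ξ : Jet n m => F (x, ξ)})ᶜ with hW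
  have hWo : IsOpen W := Ω.isOpen.inter isClosed_closure.isOpen_compl
  have : BaireSpace W := hWo.baireSpace
  have : Nonempty W := ⟨⟨x₀, hx₀, hx₀'⟩⟩
  have hc : ∀ ξ : Jet n m, Continuous fun y : W => F (y.1, ξ) := fun ξ =>
    hF.comp_continuous (by fun_prop) fun y => ⟨y.2.1, mem_univ _⟩
  let A : ℕ × Bool → Set W := fun k =>
    if k.2 then {y | ∀ ξ, F (y.1, ξ) ≤ k.1} else {y | ∀ ξ, -(k.1 : ℝ) ≤ F (y.1, ξ)}
  have hA : ∀ k, IsClosed (A k) := by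
    rintro ⟨k, b⟩
    cases b
    · simp only [A, Bool.false_eq_true, if_false, ofPred_forall]
      exact isClosed_iInter fun ξ => isClosed_le continuous_const (hc ξ)
    · simp only [A, if_true, ofPred_forall]
      exact isClosed_iInter fun ξ => isClosed_le (hc ξ) continuous_const
  have hcover : ⋃ k, A k = univ := by
    refine eq_univ_of_forall fun y => mem_iUnion.2 ?_
    have hns : ¬ Function.Surjective fun ξ : Jet n m => F (y.1, ξ) := fun hs =>
      y.2.2 (subset_closure ⟨y.2.1, hs⟩)
    obtain ⟨c, hcn⟩ := not_forall.1 hns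
    have hcont : Continuous fun ξ : Jet n m => F (y.1, ξ) :=
      hF.comp_continuous (by fun_prop) fun ξ => ⟨y.2.1, mem_univ _⟩
    obtain ⟨k, hk⟩ := exists_nat_ge |c|
    -- the connected range of `F(y, ·)` omits `c`, hence lies on one side of it
    by_cases hside : ∃ ξ, c ≤ F (y.1, ξ)
    · obtain ⟨ξ, hξ⟩ := hside
      refine ⟨(k, false), fun η => ?_⟩
      by_contra hη
      have hη' : F (y.1, η) ≤ c := by
        have := neg_abs_le c
        simp only [not_le] at hη
        linarith
      exact hcn (mem_range_of_exists_le_of_exists_ge hcont ⟨η, hη'⟩ ⟨ξ, hξ⟩)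
    · push Not at hside
      exact ⟨(k, true), fun η => (hside η).le.trans ((le_abs_self c).trans hk)⟩
  obtain ⟨⟨k, b⟩, y, hy⟩ := nonempty_interior_of_iUnion_of_closed hA hcover
  have hev : ∀ᶠ z in 𝓝 y, z ∈ A (k, b) := mem_interior_iff_mem_nhds.1 hy
  have hmap := hWo.isOpenEmbedding_subtypeVal.map_nhds_eq y
  cases b
  · refine ⟨y, -k, y.2.1, Or.inr ?_⟩
    rw [← hmap]
    exact hev
  · refine ⟨y, k, y.2.1, Or.inl ?_⟩
    rw [← hmap]
    exact hev

/-- Where all `F(x, ·)` have a common upper (lower) bound on an open set, no cut of `C^m_nd(Ω)` has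
a larger (smaller) constant as image: its right (left) set would be empty. -/
theorem hasDenseFullRange_of_surjective (hs : Function.Surjective (pdoSharp Ω F hF)) :
    HasDenseFullRange Ω F := by
  by_contra hFR
  have hex : ∀ c : ℝ, ∃ u v : Cnd m Ω,
      pdo Ω F hF u ≤ Cnd.ofContinuousOn (fun _ => c) continuousOn_const ∧
        Cnd.ofContinuousOn (fun _ => c) continuousOn_const ≤ pdo Ω F hF v := by
    intro c
    obtain ⟨U, hU⟩ := hs (CndZeroSharp.of (Cnd.ofContinuousOn (fun _ => c) continuousOn_const))
    obtain ⟨u, hu⟩ := U.2.1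
    obtain ⟨v, hv⟩ := U.2.2
    induction u using Antisymmetrization.ind with | _ u =>
    induction v using Antisymmetrization.ind with | _ v =>
    refine ⟨u.val, v.val, ?_, ?_⟩
    · have : pdoHom Ω F hF (toAntisymmetrization _ u) ∈ (pdoSharp Ω F hF U).1.left :=
        subset_lowerPolar_upperPolar (r := (· ≤ ·)) _ ⟨_, hu, rfl⟩
      rw [hU] at this
      exact this
    · have : pdoHom Ω F hF (toAntisymmetrization _ v) ∈ (pdoSharp Ω F hF U).1.right :=
        DedekindCut.image_right_subset_upperBounds (pdoHom Ω F hF).monotone U.1 ⟨_, hv, rfl⟩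
      rw [hU] at this
      exact this
  obtain ⟨x, k, hx, hk⟩ := exists_uniform_bound_of_not_hasDenseFullRange hF hFR
  rcases hk with hk | hk
  · obtain ⟨-, v, -, hv⟩ := hex (k + 1)
    obtain ⟨y, ⟨hyΩ, hyv, -⟩, hy⟩ :=
      ((Cnd.frequently_continuousAt (pdo Ω F hF v) (pdo Ω F hF v) hx).and_eventually hk).exists
    have h1 : k + 1 ≤ F (y, jet m v.toFun y) := hv y hyΩ continuousAt_const hyv
    linarith [hy (jet m v.toFun y)]
  · obtain ⟨u, -, hu, -⟩ := hex (k - 1)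
    obtain ⟨y, ⟨hyΩ, hyu, -⟩, hy⟩ :=
      ((Cnd.frequently_continuousAt (pdo Ω F hF u) (pdo Ω F hF u) hx).and_eventually hk).exists
    have h1 : F (y, jet m u.toFun y) ≤ k - 1 := hu y hyΩ hyu continuousAt_const
    linarith [hy (jet m u.toFun y)]

end Approximation

/-! ### The extended operator and its solutions -/

theorem theorem5 (n m : ℕ) (Ω : Opens (EuclideanSpace ℝ (Fin n)))
    (F : EuclideanSpace ℝ (Fin n) × Jet n m → ℝ)
    (hF : ContinuousOn F ((Ω : Set (EuclideanSpace ℝ (Fin n))) ×ˢ univ)) :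
    (∀ u : Cnd m Ω,
      pdoSharp Ω F hF (CndMSharp.of Ω F hF u) = CndZeroSharp.of (pdo Ω F hF u)) ∧
    (∀ U V : CndMSharp Ω F hF, pdoSharp Ω F hF U ≤ pdoSharp Ω F hF V ↔ U ≤ V) ∧
    (range (pdoSharp Ω F hF) = univ ↔ HasDenseFullRange Ω F) ∧
    (HasDenseFullRange Ω F →
      (∃ Φ : CndMSharp Ω F hF ≃o CndZeroSharp Ω, ⇑Φ = pdoSharp Ω F hF) ∧
      ∀ f : CndZeroSharp Ω, ∃! U : CndMSharp Ω F hF, pdoSharp Ω F hF U = f) ∧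
    ∃ (e : CndZeroSharp Ω ↪o HausdorffContinuous Ω)
      (J : CndMSharp Ω F hF ↪o HausdorffContinuous Ω),
      (∀ (u : Cnd 0 Ω) (x : Ω), ContinuousAt u.toFun x →
        (e (CndZeroSharp.of u)).lo x = (u.toFun x : EReal) ∧
        (e (CndZeroSharp.of u)).hi x = (u.toFun x : EReal)) ∧
      (∀ U : CndMSharp Ω F hF, J U = e (pdoSharp Ω F hF U)) ∧
      ∀ (f : EuclideanSpace ℝ (Fin n) → ℝ) (hf : ContinuousOn f Ω) (U : CndMSharp Ω F hF),
        pdoSharp Ω F hF U = CndZeroSharp.of (Cnd.ofContinuousOn f hf) ↔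
          ∀ x : Ω, (J U).lo x = (f x : EReal) ∧ (J U).hi x = (f x : EReal) := by
  have hemb : ∀ U V : CndMSharp Ω F hF, pdoSharp Ω F hF U ≤ pdoSharp Ω F hF V ↔ U ≤ V :=
    DedekindCompletion.map_le_map_iff _ (pdoHom_le_iff hF)
  let T : CndMSharp Ω F hF ↪o CndZeroSharp Ω := OrderEmbedding.ofMapLEIff (pdoSharp Ω F hF) hemb
  refine ⟨fun u => DedekindCompletion.map_of _ _, hemb, ?_, fun h => ⟨?_, fun f => ?_⟩, ?_⟩
  · rw [range_eq_univ]
    exact ⟨hasDenseFullRange_of_surjective, HasDenseFullRange.surjective_pdoSharp⟩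
  · exact ⟨RelIso.ofSurjective T h.surjective_pdoSharp, rfl⟩
  · obtain ⟨U, hU⟩ := h.surjective_pdoSharp (hF := hF) f
    exact ⟨U, hU, fun V hV => T.injective (hV.trans hU.symm)⟩
  · refine ⟨CndZeroSharp.hausdorffEmbedding, T.trans CndZeroSharp.hausdorffEmbedding,
      CndZeroSharp.hausdorffEmbedding_of, fun U => rfl, fun f hf U => ?_⟩
    have hfx : ∀ x : Ω, _ := fun x => CndZeroSharp.hausdorffEmbedding_of
      (Cnd.ofContinuousOn f hf) x (hf.continuousAt (Ω.isOpen.mem_nhds x.2))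
    constructor
    · intro h x
      change (CndZeroSharp.hausdorffEmbedding (pdoSharp Ω F hF U)).lo x = _ ∧
        (CndZeroSharp.hausdorffEmbedding (pdoSharp Ω F hF U)).hi x = _
      rw [h]
      exact hfx x
    · intro h
      apply CndZeroSharp.hausdorffEmbedding.injective
      apply HausdorffContinuous.ext
      · exact funext fun x => (h x).1.trans (hfx x).1.symm
      · exact funext fun x => (h x).2.trans (hfx x).2.symm
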